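/- A topological semigroup is a nonempty Hausdorff topological space with a continuous associative multiplication. A space $X$ is pseudocompact if it is Tychonoff and every continuous function $X\to\mathbb R$ is bounded. A semigroup $S$ is simple if it contains no nonempty two-sided ideal other than $S$ itself. It is completely simple if it is simple and contains a primitive idempotent, i.e. a minimal element of the set $E=\{e\in S: ee=e\}$ of idempotents with respect to the partial order $e\le f\iff ef=fe=e$. For a group $H$, sets $X,Y$ and a map $\sigma:Y\times X\to H$, the Rees product $[X,H,Y]_\sigma$ is the set $X\times H\times Y$ with the multiplication $(x,h,y)(x',h',y')=(x,h\,\sigma(y,x')\,h',y')$. A topological semigroup is a topological paragroup if it is topologically isomorphic to a Rees product $[X,H,Y]_\sigma$, with the product topology, for some Hausdorff topological group $H$, Hausdorff spaces $X,Y$ and a continuous map $\sigma:Y\times X\to H$. Theorem. Let $S$ be a pseudocompact topological semigroup. Then $S$ is a topological paragroup if and only if $S$ is completely simple. Moreover, if $S$ is completely simple, then for every idempotent $e\in S$ the maximal subgroup $H_e=eSe$, with the multiplication and topology induced from $S$, is a pseudocompact topological group. -/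

import Mathlib

universe u v w

/-- A semigroup is simple if it contains no proper two-sided ideal: every nonempty subset that
absorbs multiplication from the left and from the right is the whole semigroup. -/
def IsSimpleSemigroup (S : Type u) [Semigroup S] : Prop :=
  ∀ I : Set S, I.Nonempty → (∀ s : S, ∀ a ∈ I, s * a ∈ I ∧ a * s ∈ I) → I = Set.univ

/-- An idempotent `e` is primitive if it is minimal among the idempotents with respect to the
partial order `f ≤ e ↔ f * e = f ∧ e * f = f`. -/
def IsPrimitiveIdempotent {S : Type u} [Semigroup S] (e : S) : Prop :=
  IsIdempotentElem e ∧ ∀ f : S, IsIdempotentElem f → f * e = f → e * f = f → f = e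

/-- A semigroup is completely simple if it is simple and contains a primitive idempotent. -/
def IsCompletelySimple (S : Type u) [Semigroup S] : Prop :=
  IsSimpleSemigroup S ∧ ∃ e : S, IsPrimitiveIdempotent e

/-- A space is pseudocompact if it is Tychonoff and all its continuous real-valued functions are
bounded. -/
def IsPseudocompact (X : Type u) [TopologicalSpace X] : Prop :=
  T35Space X ∧ ∀ f : X → ℝ, Continuous f → ∃ C : ℝ, ∀ x, |f x| ≤ C

/-- The Rees product `[X, H, Y]_σ` of `H` over `X` and `Y` relative to the sandwich map `σ`; its
underlying set is `X × H × Y`. -/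
def ReesProduct {X : Type u} {H : Type v} {Y : Type w} (_σ : Y × X → H) : Type (max u v w) :=
  X × H × Y

/-- The multiplication `(x, h, y) * (x', h', y') = (x, h * σ (y, x') * h', y')`. -/
instance ReesProduct.instSemigroup {X : Type u} {H : Type v} {Y : Type w} [Group H]
    (σ : Y × X → H) : Semigroup (ReesProduct σ) where
  mul a b := (a.1, a.2.1 * σ (a.2.2, b.1) * b.2.1, b.2.2)
  mul_assoc a b c := by
    refine Prod.ext rfl (Prod.ext ?_ rfl)
    change a.2.1 * σ (a.2.2, b.1) * b.2.1 * σ (b.2.2, c.1) * c.2.1 =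
      a.2.1 * σ (a.2.2, b.1) * (b.2.1 * σ (b.2.2, c.1) * c.2.1)
    simp only [mul_assoc]

/-- The Rees product carries the product topology. -/
instance ReesProduct.instTopologicalSpace {X : Type u} {H : Type v} {Y : Type w}
    [TopologicalSpace X] [TopologicalSpace H] [TopologicalSpace Y] (σ : Y × X → H) :
    TopologicalSpace (ReesProduct σ) :=
  inferInstanceAs (TopologicalSpace (X × H × Y))

/-- A semigroup with a topology is a topological paragroup if it is topologically isomorphic to a
Rees product `[X, H, Y]_σ` of a (Hausdorff) topological group `H` over (Hausdorff) topological
spaces `X`, `Y` with a continuous sandwich map `σ : Y × X → H`. -/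
def IsTopologicalParagroup (S : Type u) [Semigroup S] [TopologicalSpace S] : Prop :=
  ∃ (X H Y : Type u) (_ : TopologicalSpace X) (_ : T2Space X) (_ : TopologicalSpace H)
    (_ : T2Space H) (_ : TopologicalSpace Y) (_ : T2Space Y)
    (_ : Group H) (_ : IsTopologicalGroup H) (σ : Y × X → H),
    Continuous σ ∧ Nonempty (S ≃ₜ* ReesProduct σ)

/-- The given multiplication and topology of `T` are those of a topological group. -/
def FormsTopologicalGroup (T : Type u) [inst : Semigroup T] [TopologicalSpace T] : Prop :=
  ∃ G : Group T, G.toDivInvMonoid.toMonoid.toSemigroup = inst ∧ IsTopologicalGroup T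

open Set Topology

/-! ### Algebra of completely simple semigroups -/

/-! A Rees product over a group is completely simple for purely algebraic reasons. Conversely,
simplicity and a primitive idempotent make every corner `eSe` a group
(`IsCompletelySimple.exists_mul_eq`). The corner is a retract of `S` under `s ↦ ese`, hence
pseudocompact. The topological core is `isTopologicalGroup_of_not_locallyFinite`: were inversion
discontinuous at `1`, one could build a locally finite sequence of nonempty open sets, which
pseudocompactness forbids. Once inversion in `eSe` is continuous, so is `g s = (ese)⁻¹`, and `s ↦ (s
* g s, ese, g s * s)` gives continuous Rees coordinates. -/

/-- In a simple semigroup every element is a product through any given element. -/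
theorem IsSimpleSemigroup.exists_mul_mul_eq {S : Type u} [Semigroup S] (h : IsSimpleSemigroup S)
    (a s : S) : ∃ x y, x * a * y = s := by
  have : {t | ∃ x y, x * a * y = t} = univ := by
    refine h _ ⟨a * a * a, a, a, rfl⟩ ?_
    rintro t _ ⟨x, y, rfl⟩
    exact ⟨⟨t * x, y, by simp only [mul_assoc]⟩, ⟨x, y * t, by simp only [mul_assoc]⟩⟩
  exact this.superset (mem_univ s)

/-- Every element of the corner of a primitive idempotent of a simple semigroup has a right
inverse. -/
theorem IsPrimitiveIdempotent.exists_mul_eq {S : Type u} [Semigroup S] (h : IsSimpleSemigroup S)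
    {e : S} (he : IsPrimitiveIdempotent e) {a : S} (ha : a ∈ Subsemigroup.corner e) :
    ∃ b ∈ Subsemigroup.corner e, a * b = e := by
  obtain ⟨hi, hmin⟩ := he
  obtain ⟨hea, hae⟩ := (Subsemigroup.mem_corner_iff hi).1 ha
  obtain ⟨x, y, hxy⟩ := h.exists_mul_mul_eq a e
  have hee : e * e = e := hi
  have hkey : (e * x * e) * a * (e * y * e) = e := by grind
  -- The product `a * y' * x'`, with `x' = exe` and `y' = eye`, is an idempotent below `e`, so
  -- primitivity makes it `e`.
  have hf := hmin (a * (e * y * e) * (e * x * e))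
    (by unfold IsIdempotentElem; grind) (by grind) (by grind)
  exact ⟨(e * y * e) * (e * x * e), ⟨y * e * e * x, by simp only [mul_assoc]⟩, by
    rw [← mul_assoc, hf]⟩

/-- Every element of the corner of an idempotent of a completely simple semigroup has a right
inverse. -/
theorem IsCompletelySimple.exists_mul_eq {S : Type u} [Semigroup S] (h : IsCompletelySimple S)
    {f : S} (hf : IsIdempotentElem f) {a : S} (ha : a ∈ Subsemigroup.corner f) :
    ∃ b ∈ Subsemigroup.corner f, a * b = f := by
  obtain ⟨hs, e, he⟩ := h
  have hee : e * e = e := he.1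
  have hff : f * f = f := hf
  obtain ⟨x, y, hxy⟩ := hs.exists_mul_mul_eq e f
  -- Since `p * q = f` factors through `e`, the map `a ↦ q * a * p` carries the corner of `f` to
  -- that of `e`; an inverse `b` found there returns as `p * b * q`.
  obtain ⟨p, q, hfp, hpe, heq, hqf, hpq⟩ :
      ∃ p q, f * p = p ∧ p * e = p ∧ e * q = q ∧ q * f = q ∧ p * q = f :=
    ⟨f * x * e, e * y * f, by grind, by grind, by grind, by grind, by grind⟩
  have hfa := ((Subsemigroup.mem_corner_iff hf).1 ha).1
  obtain ⟨u, -, hu⟩ := he.exists_mul_eq hs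
    ((Subsemigroup.mem_corner_iff he.1).2 (by grind) : q * p ∈ Subsemigroup.corner e)
  obtain ⟨b, -, hb⟩ := he.exists_mul_eq hs
    ((Subsemigroup.mem_corner_iff he.1).2 (by grind) : q * a * p ∈ Subsemigroup.corner e)
  exact ⟨p * b * q, (Subsemigroup.mem_corner_iff hf).2 (by grind), by grind⟩

/-- The group structure on the corner of an idempotent in which all elements have right
inverses. -/
noncomputable abbrev Subsemigroup.cornerGroup {S : Type u} [Semigroup S] {e : S}
    (he : IsIdempotentElem e)
    (hinv : ∀ a ∈ Subsemigroup.corner e, ∃ b ∈ Subsemigroup.corner e, a * b = e) :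
    Group (Subsemigroup.corner e) :=
  letI : One (Subsemigroup.corner e) := ⟨⟨e, e, by simp only [he.eq]⟩⟩
  letI : Inv (Subsemigroup.corner e) :=
    ⟨fun a => ⟨(hinv a a.2).choose, (hinv a a.2).choose_spec.1⟩⟩
  Group.ofRightAxioms mul_assoc
    (fun a => Subtype.ext ((Subsemigroup.mem_corner_iff he).1 a.2).2)
    (fun a => Subtype.ext (hinv a a.2).choose_spec.2)

/-- In a simple semigroup, if the corner of `e` is a group then `g` being inverse to `e * s * e` in the corner of `e`
implies that it is an inner inverse of `s`. -/
theorem IsSimpleSemigroup.mul_mul_eq_self {S : Type u} [Semigroup S] (h : IsSimpleSemigroup S)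
    {e : S} (he : IsIdempotentElem e)
    (hinv : ∀ a ∈ Subsemigroup.corner e, ∃ b ∈ Subsemigroup.corner e, a * b = e ∧ b * a = e)
    {s g : S} (hg : g ∈ Subsemigroup.corner e) (hsg : e * s * e * g = e) :
    s * g * s = s := by
  have hee : e * e = e := he
  obtain ⟨heg, hge⟩ := (Subsemigroup.mem_corner_iff he).1 hg
  -- With `s = x * e * y`, the element `ese` is `(exe)(eye)`, which forces `g = b' * a'`; both
  -- factors then cancel inside `s * g * s`.
  obtain ⟨x, y, rfl⟩ := h.exists_mul_mul_eq e s
  obtain ⟨a', ha', -, ha⟩ := hinv (e * x * e) ⟨x, rfl⟩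
  obtain ⟨b', hb', hb, hb2⟩ := hinv (e * y * e) ⟨y, rfl⟩
  obtain ⟨h1, h2⟩ := (Subsemigroup.mem_corner_iff he).1 ha'
  obtain ⟨h3, h4⟩ := (Subsemigroup.mem_corner_iff he).1 hb'
  clear hinv
  have h5 : a' * (e * x * e) * (e * y * e) * g = a' * e := by rw [← hsg]; grind
  have h6 : b' * (e * y * e) * g = b' * a' := by
    rw [ha, h2] at h5
    rw [← h5]
    grind
  have hgeq : g = b' * a' := by rw [← h6, hb2, heg]
  subst hgeq
  have h7 : x * e * y * (b' * a') * (x * e * y) =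
      x * (e * y * e * b') * (a' * (e * x * e)) * (e * y) := by grind
  rw [h7, hb, ha]
  grind

theorem IsCompletelySimple.of_mulEquiv {S : Type u} {T : Type v} [Semigroup S] [Semigroup T]
    (φ : S ≃* T) (h : IsCompletelySimple T) : IsCompletelySimple S := by
  obtain ⟨hs, e, he, hmin⟩ := h
  refine ⟨fun I hI hmul => ?_, φ.symm e, ?_, fun f hf h1 h2 => ?_⟩
  · have : φ.symm ⁻¹' I = univ := by
      refine hs _ (hI.preimage φ.symm.surjective) fun s a ha => ?_
      simpa only [mem_preimage, map_mul] using hmul (φ.symm s) _ ha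
    exact φ.symm.surjective.preimage_injective (by rw [this, preimage_univ])
  · exact he.map φ.symm
  · rw [← φ.apply_eq_iff_eq] at h1 h2
    rw [φ.eq_symm_apply]
    exact hmin _ (hf.map φ) (by simpa using h1) (by simpa using h2)

/-- Every idempotent is `(x, σ(y, x)⁻¹, y)`, and comparable idempotents share `x` and `y`, so all of
them are primitive. -/
theorem ReesProduct.isCompletelySimple {X : Type u} {H : Type v} {Y : Type w} [Group H]
    (σ : Y × X → H) [Nonempty (ReesProduct σ)] : IsCompletelySimple (ReesProduct σ) := by
  have key : ∀ f : ReesProduct σ, IsIdempotentElem f → f.2.1 = (σ (f.2.2, f.1))⁻¹ := by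
    intro f hf
    have h1 : f.2.1 * σ (f.2.2, f.1) * f.2.1 = f.2.1 := congrArg (fun t => t.2.1) hf
    rw [mul_eq_right] at h1
    exact eq_inv_of_mul_eq_one_left h1
  refine ⟨?_, ?_⟩
  · rintro I ⟨a, ha⟩ hI
    refine eq_univ_of_forall fun t => ?_
    have h1 := (hI (t.1, t.2.1 * (σ (t.2.2, a.1) * a.2.1 * σ (a.2.2, t.1))⁻¹, t.2.2) _ ha).1
    have h2 := (hI (t.1, 1, t.2.2) _ h1).2
    convert h2 using 1
    refine Prod.ext rfl (Prod.ext ?_ rfl)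
    change t.2.1 = t.2.1 * (σ (t.2.2, a.1) * a.2.1 * σ (a.2.2, t.1))⁻¹ * σ (t.2.2, a.1) * a.2.1 *
      σ (a.2.2, t.1) * 1
    group
  · obtain ⟨x, h, y⟩ := ‹Nonempty (ReesProduct σ)›
    refine ⟨(x, (σ (y, x))⁻¹, y), ?_, ?_⟩
    · refine Prod.ext rfl (Prod.ext ?_ rfl)
      change (σ (y, x))⁻¹ * σ (y, x) * (σ (y, x))⁻¹ = (σ (y, x))⁻¹
      group
    · intro f hf h1 h2
      have hx : x = f.1 := congrArg (fun t => t.1) h2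
      have hy : y = f.2.2 := congrArg (fun t => t.2.2) h1
      refine Prod.ext hx.symm (Prod.ext ?_ hy.symm)
      change f.2.1 = (σ (y, x))⁻¹
      rw [hx, hy, key f hf]

/-! ### Pseudocompactness and continuity of inversion -/

/-- In a pseudocompact space no sequence of nonempty open sets is locally finite. -/
theorem IsPseudocompact.not_locallyFinite {X : Type u} [TopologicalSpace X]
    (hX : IsPseudocompact X) {O : ℕ → Set X} (ho : ∀ n, IsOpen (O n))
    (hne : ∀ n, (O n).Nonempty) : ¬ LocallyFinite O := by
  intro hlf
  obtain ⟨_, hb⟩ := hX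
  choose x hx using hne
  -- Bumps of height `n` at `x n`: local finiteness makes their sum continuous, yet it is unbounded.
  have hf : ∀ n, ∃ f : X → ℝ, Continuous f ∧ (∀ y, 0 ≤ f y) ∧ f (x n) = n ∧
      Function.support f ⊆ O n := by
    intro n
    obtain ⟨f, hfc, hfx, hfo⟩ :=
      CompletelyRegularSpace.completely_regular_isOpen (x n) (O n) (ho n) (hx n)
    refine ⟨fun y => n * (1 - f y), by fun_prop,
      fun y => mul_nonneg n.cast_nonneg (sub_nonneg.2 (f y).2.2), by simp [hfx], fun y hy => ?_⟩
    by_contra hyO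
    exact hy (by simp [hfo hyO])
  choose f hfc hf0 hfx hfo using hf
  have hlf' : LocallyFinite fun n => Function.support (f n) := hlf.subset hfo
  obtain ⟨C, hC⟩ := hb _ (continuous_finsum hfc hlf')
  obtain ⟨n, hn⟩ := exists_nat_gt C
  have h1 : f n (x n) ≤ ∑ᶠ i, f i (x n) :=
    single_le_finsum n (hlf'.point_finite (x n)) fun i => hf0 i _
  rw [hfx] at h1
  exact absurd ((le_abs_self _).trans (hC (x n))) (by linarith)

theorem IsPseudocompact.of_retract {X : Type u} {Y : Type v} [TopologicalSpace X]
    [TopologicalSpace Y] (hX : IsPseudocompact X) {i : Y → X} {r : X → Y} (hi : Continuous i)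
    (hr : Continuous r) (hri : Function.LeftInverse r i) : IsPseudocompact Y := by
  obtain ⟨_, hb⟩ := hX
  refine ⟨(hri.isEmbedding hr hi).t35Space, fun f hf => ?_⟩
  obtain ⟨C, hC⟩ := hb (f ∘ r) (hf.comp hr)
  exact ⟨C, fun y => by simpa [hri y] using hC (i y)⟩

section Paratopological

variable {G : Type u} [Group G] [TopologicalSpace G] [ContinuousMul G]

open Pointwise in
/-- If `V` is an open neighbourhood of `1` and `closure (V * V)` is contained in a set whose inverse
is not a neighbourhood of `1`, then every nonempty open set contains nonempty open sets `O` and `W`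
such that `O` is disjoint from `W * V`. -/
theorem exists_isOpen_disjoint_mul [RegularSpace G] {V A : Set G} (hV : IsOpen V)
    (h1 : (1 : G) ∈ V) (hVA : closure (V * V) ⊆ A) (hA : A⁻¹ ∉ 𝓝 (1 : G)) {U : Set G}
    (hU : IsOpen U) (hUne : U.Nonempty) :
    ∃ O W : Set G, IsOpen O ∧ O.Nonempty ∧ O ⊆ U ∧ IsOpen W ∧ W.Nonempty ∧ closure W ⊆ U ∧
      Disjoint O (W * V) := by
  have hshrink : ∀ x ∈ U, ∃ W, IsOpen W ∧ x ∈ W ∧ closure W ⊆ U ∧ W ⊆ x • V := by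
    intro x hx
    have hmem : U ∩ x • V ∈ 𝓝 x := (hU.inter (hV.smul x)).mem_nhds
      ⟨hx, by simpa using smul_mem_smul_set (a := x) h1⟩
    obtain ⟨K, hK, hKc, hKs⟩ := exists_mem_nhds_isClosed_subset hmem
    exact ⟨interior K, isOpen_interior, mem_interior_iff_mem_nhds.2 hK,
      (hKc.closure_interior_subset).trans (hKs.trans inter_subset_left),
      interior_subset.trans (hKs.trans inter_subset_right)⟩
  -- If `U` is not inside some `closure (x • (V * V))`, remove that closure to get `O` and take `W ⊆
  -- x • V`. Otherwise `z⁻¹ ∈ closure (V * V) ⊆ A` whenever `v * z ∈ U`, so `A⁻¹` is a neighbourhood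
  -- of `1`.
  by_cases hex : ∃ x ∈ U, (U \ closure (x • (V * V))).Nonempty
  · obtain ⟨x, hx, hne⟩ := hex
    obtain ⟨W, hWo, hxW, hWU, hWV⟩ := hshrink x hx
    refine ⟨_, W, hU.sdiff isClosed_closure, hne, sdiff_subset, hWo, ⟨x, hxW⟩, hWU, ?_⟩
    refine disjoint_sdiff_left.mono_right (subset_closure.trans' ?_)
    rw [← smul_mul_assoc]
    exact mul_subset_mul_right hWV
  · exfalso
    push Not at hex
    obtain ⟨v, hv⟩ := hUne
    refine hA (Filter.mem_of_superset ((hU.preimage (continuous_const_mul v)).mem_nhds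
      (by simpa using hv : (1 : G) ∈ (v * ·) ⁻¹' U)) fun z hz => ?_)
    have hzU : v * z ∈ U := hz
    have hcl : v ∈ closure ((v * z) • (V * V)) := by
      by_contra hcon
      exact (hex _ hzU).subset ⟨hv, hcon⟩
    rw [closure_smul, mem_smul_set_iff_inv_smul_mem] at hcl
    simpa using hVA hcl

open Pointwise in
/-- A regular group with jointly continuous multiplication in which no sequence of nonempty open
sets is locally finite is a topological group. -/
theorem isTopologicalGroup_of_not_locallyFinite [RegularSpace G]
    (hG : ∀ O : ℕ → Set G, (∀ n, IsOpen (O n)) → (∀ n, (O n).Nonempty) → ¬ LocallyFinite O) :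
    IsTopologicalGroup G := by
  have hinv1 : Filter.Tendsto (fun x : G => x⁻¹) (𝓝 1) (𝓝 1) := by
    intro A hA
    by_contra hAinv
    obtain ⟨K, hK, hKc, hKA⟩ := exists_mem_nhds_isClosed_subset hA
    obtain ⟨V, hVo, hV1, hVK⟩ := exists_open_nhds_one_mul_subset hK
    have hVA : closure (V * V) ⊆ A := (closure_minimal hVK hKc).trans hKA
    choose O W hOo hOne hOU hWo hWne hWU hd using fun U : {U : Set G // IsOpen U ∧ U.Nonempty} =>
      exists_isOpen_disjoint_mul hVo hV1 hVA hAinv U.2.1 U.2.2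
    let U : ℕ → {U : Set G // IsOpen U ∧ U.Nonempty} := fun n =>
      n.rec ⟨univ, isOpen_univ, univ_nonempty⟩ fun _ U => ⟨W U, hWo U, hWne U⟩
    have hmono : Antitone fun n => (U n).1 :=
      antitone_nat_of_succ_le fun n => Subset.trans subset_closure (hWU (U n))
    refine hG (fun n => O (U n)) (fun n => hOo _) (fun n => hOne _) fun p => ?_
    -- If `p` lies in every `W (U n)`, then `p • V` misses every `O (U n)`. Otherwise `p` lies
    -- outside some `closure (W (U (n + 1)))`, which contains `O (U m)` for all `m ≥ n + 2` because
    -- `U (n + 2) = W (U (n + 1))`.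
    by_cases hp : ∀ n, p ∈ W (U n)
    · refine ⟨p • V, (hVo.smul p).mem_nhds (by simpa using smul_mem_smul_set (a := p) hV1), ?_⟩
      convert finite_empty
      refine eq_empty_of_forall_notMem fun n hn => ?_
      obtain ⟨z, hz, hzV⟩ := hn
      obtain ⟨v, hv, rfl⟩ := hzV
      exact (hd (U n)).notMem_of_mem_left hz (mul_mem_mul (hp n) hv)
    · push Not at hp
      obtain ⟨n, hn⟩ := hp
      have hncl : p ∉ closure (W (U (n + 1))) := fun h => hn (hWU _ h)
      refine ⟨(closure (W (U (n + 1))))ᶜ, isClosed_closure.isOpen_compl.mem_nhds hncl, ?_⟩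
      refine (finite_lt_nat (n + 2)).subset fun m hm => ?_
      by_contra hmn
      obtain ⟨z, hz, hzV⟩ := hm
      exact hzV (subset_closure (hmono (not_lt.1 hmn) (hOU _ hz)))
  refine { continuous_inv := continuous_iff_continuousAt.2 fun a => ?_ }
  have h2 : Filter.Tendsto (fun x : G => (a⁻¹ * x)⁻¹ * a⁻¹) (𝓝 a) (𝓝 (1 * a⁻¹)) := by
    refine Filter.Tendsto.mul_const _ (hinv1.comp ?_)
    simpa using (continuous_const_mul a⁻¹).tendsto a
  simpa [ContinuousAt] using h2

end Paratopological

/-! ### The main theorem -/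

theorem IsPseudocompact.corner {S : Type u} [Semigroup S] [TopologicalSpace S] [ContinuousMul S]
    (hS : IsPseudocompact S) {e : S} (he : IsIdempotentElem e) :
    IsPseudocompact (Subsemigroup.corner e) :=
  hS.of_retract (i := Subtype.val) (r := fun s => ⟨e * s * e, s, rfl⟩) continuous_subtype_val
    (by fun_prop) fun a => Subtype.ext (by
      obtain ⟨h1, h2⟩ := (Subsemigroup.mem_corner_iff he).1 a.2
      simp only [h1, h2])

theorem IsPseudocompact.isTopologicalGroup {G : Type u} [Group G] [TopologicalSpace G]
    [ContinuousMul G] (hG : IsPseudocompact G) : IsTopologicalGroup G :=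
  haveI := hG.1
  isTopologicalGroup_of_not_locallyFinite fun _ ho hne => hG.not_locallyFinite ho hne

/-- This and the next two identities recover the coordinates `x`, `y`, `h` from the product `x * h *
y`; `k` stands for the inverse of `h` in the corner of `e`. -/
theorem mul_mul_mul_eq_left {S : Type u} [Semigroup S] {e x h y k : S} (hx : x * e = x)
    (hy : y * e = e) (hk : e * k = k) (hhk : h * k = e) :
    x * h * y * k = x := by
  rw [mul_assoc, ← hk, ← mul_assoc y, hy, hk, mul_assoc, hhk, hx]

theorem mul_mul_mul_eq_right {S : Type u} [Semigroup S] {e x h y k : S} (hx : e * x = e)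
    (hy : e * y = y) (hk : k * e = k) (hkh : k * h = e) :
    k * (x * h * y) = y := by
  rw [mul_assoc x, ← mul_assoc, ← hk, mul_assoc k, hx, hk, ← mul_assoc, hkh, hy]

theorem mul_mul_mul_eq_mid {S : Type u} [Semigroup S] {e x h y : S} (hx : e * x = e)
    (hy : y * e = e) (hh : e * h = h) (hh' : h * e = h) :
    e * (x * h * y) * e = h := by
  rw [mul_assoc, mul_assoc _ y, hy, ← mul_assoc, ← mul_assoc, hx, hh, hh']

/-- A simple topological semigroup is a topological paragroup as soon as the corner of
one of its idempotents is a topological group. -/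
theorem IsSimpleSemigroup.isTopologicalParagroup {S : Type u} [Semigroup S] [TopologicalSpace S]
    [ContinuousMul S] [T2Space S] (hs : IsSimpleSemigroup S) {e : S} (he : IsIdempotentElem e)
    (hinv : ∀ a ∈ Subsemigroup.corner e, ∃ b ∈ Subsemigroup.corner e, a * b = e)
    (htop : @IsTopologicalGroup _ _ (Subsemigroup.cornerGroup he hinv)) :
    IsTopologicalParagroup S := by
  let _ := Subsemigroup.cornerGroup he hinv
  have := htop
  have hee : e * e = e := he
  have hl : ∀ a : Subsemigroup.corner e, e * (a : S) = a :=
    fun a => ((Subsemigroup.mem_corner_iff he).1 a.2).1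
  have hr : ∀ a : Subsemigroup.corner e, (a : S) * e = a :=
    fun a => ((Subsemigroup.mem_corner_iff he).1 a.2).2
  have hmi : ∀ a : Subsemigroup.corner e, (a : S) * (a⁻¹ : Subsemigroup.corner e) = e :=
    fun a => congrArg Subtype.val (mul_inv_cancel a)
  have him : ∀ a : Subsemigroup.corner e, ((a⁻¹ : Subsemigroup.corner e) : S) * a = e :=
    fun a => congrArg Subtype.val (inv_mul_cancel a)
  let r : S → Subsemigroup.corner e := fun s => ⟨e * s * e, s, rfl⟩
  have hrc : Continuous r := by fun_prop
  obtain ⟨g, hg⟩ : ∃ g : S → S, ∀ s, g s = ((r s)⁻¹ : Subsemigroup.corner e) := ⟨_, fun _ => rfl⟩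
  have hgc : Continuous g := by
    rw [funext hg]
    fun_prop
  have heg : ∀ s, e * g s = g s := fun s => hg s ▸ hl _
  have hge : ∀ s, g s * e = g s := fun s => hg s ▸ hr _
  have h1 : ∀ s, e * s * e * g s = e := fun s => hg s ▸ hmi (r s)
  have h2 : ∀ s, g s * (e * s * e) = e := fun s => hg s ▸ him (r s)
  have h3 : ∀ s, s * g s * s = s := fun s =>
    hs.mul_mul_eq_self he (fun a ha => ⟨_, (⟨a, ha⟩⁻¹ : Subsemigroup.corner e).2, hmi ⟨a, ha⟩,
      him ⟨a, ha⟩⟩) (hg s ▸ Subtype.prop _) (h1 s)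
  have h4 : ∀ s, s * g s * e = s * g s := fun s => by rw [mul_assoc, hge]
  have h5 : ∀ s, e * (s * g s) = e := fun s => by
    rw [← heg, ← mul_assoc, ← mul_assoc, h1]
  have h6 : ∀ s, e * (g s * s) = g s * s := fun s => by rw [← mul_assoc, heg]
  have h7 : ∀ s, g s * s * e = e := fun s => by
    rw [← hge, mul_assoc, mul_assoc, ← mul_assoc e, h2]
  have h8 : ∀ s, s * g s * (e * s * e) * (g s * s) = s := fun s => by
    rw [mul_assoc s, h2, mul_assoc, h6, ← mul_assoc, h3]
  -- `X` and `Y` consist of idempotents of `Se` and `eS`. The sandwich map is multiplication `(y, x)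
  -- ↦ y * x`, which lands in `eSe`.
  let X : Set S := {x | x * e = x ∧ e * x = e}
  let Y : Set S := {y | e * y = y ∧ y * e = e}
  let σ : Y × X → Subsemigroup.corner e := fun p => ⟨p.1 * p.2,
    (Subsemigroup.mem_corner_iff he).2
      ⟨by rw [← mul_assoc, p.1.2.1], by rw [mul_assoc, p.2.2.1]⟩⟩
  have hrval : ∀ (x : X) (h : Subsemigroup.corner e) (y : Y), r (x * h * y) = h := fun x h y =>
    Subtype.ext (mul_mul_mul_eq_mid x.2.2 y.2.2 (hl h) (hr h))
  refine ⟨X, Subsemigroup.corner e, Y, inferInstance, inferInstance, inferInstance, inferInstance,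
    inferInstance, inferInstance, inferInstance, inferInstance, σ, by fun_prop, ⟨?_⟩⟩
  refine ContinuousMulEquiv.symm
    { toFun := fun p => (p.1 : S) * (p.2.1 : S) * (p.2.2 : S)
      invFun := fun s => (⟨s * g s, h4 s, h5 s⟩, r s, ⟨g s * s, h6 s, h7 s⟩)
      left_inv := ?_
      right_inv := ?_
      map_mul' := ?_
      continuous_toFun := ?_
      continuous_invFun := ?_ }
  · rintro ⟨x, h, y⟩
    have hgv : g (x * h * y) = (h⁻¹ : Subsemigroup.corner e) := by rw [hg, hrval]
    refine Prod.ext (Subtype.ext ?_) (Prod.ext (hrval x h y) (Subtype.ext ?_))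
    · change (x * h * y : S) * g (x * h * y) = x
      rw [hgv]
      exact mul_mul_mul_eq_left x.2.1 y.2.2 (hl _) (hmi h)
    · change g (x * h * y) * (x * h * y : S) = y
      rw [hgv]
      exact mul_mul_mul_eq_right x.2.2 y.2.1 (hr _) (him h)
  · exact h8
  · intro p q
    change (p.1 : S) * ((p.2.1 : S) * ((p.2.2 : S) * q.1) * q.2.1) * q.2.2 = _
    simp only [mul_assoc]
  · change Continuous fun p : X × Subsemigroup.corner e × Y => (p.1 : S) * (p.2.1 : S) * (p.2.2 : S)
    fun_prop
  · change Continuous fun s => ((⟨s * g s, _⟩, r s, ⟨g s * s, _⟩) : X × Subsemigroup.corner e × Y)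
    fun_prop

theorem mainTheorem4 {S : Type u} [Nonempty S] [Semigroup S] [TopologicalSpace S]
    [ContinuousMul S] (hS : IsPseudocompact S) :
    (IsTopologicalParagroup S ↔ IsCompletelySimple S) ∧
    (IsCompletelySimple S → ∀ e : S, IsIdempotentElem e →
      IsPseudocompact (Subsemigroup.corner e) ∧
      FormsTopologicalGroup (Subsemigroup.corner e)) := by
  have := hS.1
  have htop : ∀ (h : IsCompletelySimple S) (e : S) (he : IsIdempotentElem e),
      @IsTopologicalGroup _ _ (Subsemigroup.cornerGroup he fun _ => h.exists_mul_eq he) := by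
    intro h e he
    let := Subsemigroup.cornerGroup he fun _ => h.exists_mul_eq he
    have : ContinuousMul (Subsemigroup.corner e) :=
      ⟨Continuous.subtype_mk (by fun_prop) _⟩
    exact (hS.corner he).isTopologicalGroup
  refine ⟨⟨?_, fun h => ?_⟩, fun h e he => ⟨hS.corner he, _, ?_, htop h e he⟩⟩
  · rintro ⟨X, H, Y, _, _, _, _, _, _, _, _, σ, -, ⟨φ⟩⟩
    have : Nonempty (ReesProduct σ) := Nonempty.map φ inferInstance
    exact (ReesProduct.isCompletelySimple σ).of_mulEquiv φ.toMulEquiv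
  · obtain ⟨e, he⟩ := h.2
    exact h.1.isTopologicalParagroup he.1 _ (htop h e he.1)
  -- The multiplication of `Subsemigroup.cornerGroup` is the induced one by definition.
  · rfl
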